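/- Let $\Gamma\subset SU(2)$ be a finite subgroup, let $\mathbb V=(\mathbb C^2\setminus\{0\})/\Gamma$ with the complex structure and the flat metric $g_0$ induced from $\mathbb C^2$, let $\nabla_0$ be the Levi-Civita connection of $g_0$, let $r$ be the distance from the origin, and let $S^1=\{\lambda\in\mathbb C : |\lambda|=1\}$ act on $\mathbb V$ by scalar multiplication. Let $\gamma$ be a smooth real $S^1$-invariant $1$-form on $\mathbb V$ such that $d\gamma$ is of type $(1,1)$ and, for every $k\ge 0$, $|\nabla_0^k\gamma|_{g_0}=O(r^{-3-k})$ as $r\to\infty$. Then there is a smooth real-valued $S^1$-invariant function $\psi$ on $\mathbb V$ such that $$d\gamma=\sqrt{-1}\,\partial\overline{\partial}\psi \quad\text{on } \mathbb V$$ and, for every $k\ge 0$, $|\nabla_0^k\psi|_{g_0}=O(r^{-2-k})$ as $r\to\infty$. Moreover, if the bounds on $\gamma$ hold on all of $\mathbb V$ (that is, for every $k\ge0$ there is a constant $C_k$ with $|\nabla_0^k\gamma|_{g_0}\le C_k r^{-3-k}$ on $\mathbb V$), then the bounds on this $\psi$ also hold on all of $\mathbb V$ (for every $k\ge0$ there is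 a constant $C'_k$ with $|\nabla_0^k\psi|_{g_0}\le C'_k r^{-2-k}$ on $\mathbb V$). -/

import Mathlib

noncomputable section

namespace QuotientPotential

open scoped ContDiff

/-- `ℂ²` with its standard Hermitian norm; `‖x‖` is the distance `r` from the origin. -/
abbrev C2 : Type := EuclideanSpace ℂ (Fin 2)

/-- The real-linear map `x ↦ A x` of `ℂ²` given by a matrix `A`. -/
def matAct (A : Matrix (Fin 2) (Fin 2) ℂ) : C2 →L[ℝ] C2 :=
  (Matrix.toEuclideanCLM (n := Fin 2) (𝕜 := ℂ) A).restrictScalars ℝ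

/-- The real-linear map `x ↦ c x` of `ℂ²` given by a complex scalar `c`. For `c = i` it is the
standard complex structure `I`, and for `|c| = 1` it is the action of `S¹`. -/
def scalarAct (c : ℂ) : C2 →L[ℝ] C2 :=
  (c • ContinuousLinearMap.id ℂ C2).restrictScalars ℝ

variable {F : Type*} [NormedAddCommGroup F] [NormedSpace ℝ F] {n : ℕ}

/-- The pullback `L^* α` of an `n`-form by a linear map `L`:
`(L^* α)_x (v₁, …, vₙ) = α_{L x} (L v₁, …, L vₙ)`. -/
def pullback (L : C2 →L[ℝ] C2) (α : C2 → C2 [⋀^Fin n]→L[ℝ] F) (x : C2) :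
    C2 [⋀^Fin n]→L[ℝ] F :=
  (α (L x)).compContinuousLinearMap L

/-- `α` is a smooth `n`-form on `𝕍 = (ℂ² ∖ {0}) / Γ`. As `Γ ⊂ SU(2)` acts freely on `ℂ² ∖ {0}`,
the quotient map is a covering, and forms on `𝕍` are the `Γ`-invariant forms on `ℂ² ∖ {0}`.
The value of `α` at the origin plays no role. -/
def IsSmoothForm (Γ : Subgroup (Matrix.specialUnitaryGroup (Fin 2) ℂ))
    (α : C2 → C2 [⋀^Fin n]→L[ℝ] F) : Prop :=
  ContDiffOn ℝ ∞ α {0}ᶜ ∧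
    ∀ g ∈ Γ, ∀ x : C2, x ≠ 0 → pullback (matAct (g : Matrix (Fin 2) (Fin 2) ℂ)) α x = α x

/-- The `n`-form `α` is invariant under the action of `S¹` by scalars. -/
def IsCircleInvariantForm (α : C2 → C2 [⋀^Fin n]→L[ℝ] F) : Prop :=
  ∀ c : ℂ, ‖c‖ = 1 → ∀ x : C2, x ≠ 0 → pullback (scalarAct c) α x = α x

/-- `ψ` is a smooth function on `𝕍 = (ℂ² ∖ {0}) / Γ`, given by its `Γ`-invariant lift to
`ℂ² ∖ {0}`. -/
def IsSmoothFunction (Γ : Subgroup (Matrix.specialUnitaryGroup (Fin 2) ℂ))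
    (ψ : C2 → ℝ) : Prop :=
  ContDiffOn ℝ ∞ ψ {0}ᶜ ∧
    ∀ g ∈ Γ, ∀ x : C2, x ≠ 0 → ψ (matAct (g : Matrix (Fin 2) (Fin 2) ℂ) x) = ψ x

/-- The function `ψ` is invariant under the action of `S¹` by scalars. -/
def IsCircleInvariantFunction (ψ : C2 → ℝ) : Prop :=
  ∀ c : ℂ, ‖c‖ = 1 → ∀ x : C2, x ≠ 0 → ψ (scalarAct c x) = ψ x

/-- The `2`-form `α` on `ℂ² ∖ {0}` is of type `(1,1)`: `α(I u, I v) = α(u, v)`. -/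
def IsType11 (α : C2 → C2 [⋀^Fin 2]→L[ℝ] F) : Prop :=
  ∀ x : C2, x ≠ 0 → (α x).compContinuousLinearMap (scalarAct Complex.I) = α x

/-- The `(1,1)`-part of a complex `2`-form: the average of `α` and `I^* α`. (`I^*` is the identity
on `(1,1)`-forms and minus the identity on `(2,0)`- and `(0,2)`-forms.) -/
def part11 (α : C2 [⋀^Fin 2]→L[ℝ] ℂ) : C2 [⋀^Fin 2]→L[ℝ] ℂ :=
  (2⁻¹ : ℝ) • (α + α.compContinuousLinearMap (scalarAct Complex.I))

/-- `∂̄ψ`, the `(0,1)`-part of `dψ`: `(∂̄ψ)(v) = (dψ(v) + i dψ(I v)) / 2`. -/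
def dbar (ψ : C2 → ℝ) (x : C2) : C2 [⋀^Fin 1]→L[ℝ] ℂ :=
  ContinuousAlternatingMap.ofSubsingleton ℝ C2 ℂ (0 : Fin 1)
    ((2⁻¹ : ℝ) • (Complex.ofRealCLM.comp (fderiv ℝ ψ x) +
      Complex.I • Complex.ofRealCLM.comp ((fderiv ℝ ψ x).comp (scalarAct Complex.I))))

/-- `∂∂̄ψ`. As `∂̄ψ` is of type `(0,1)`, its image under `∂` is the `(1,1)`-part of `d(∂̄ψ)`. -/
def ddbar (ψ : C2 → ℝ) (x : C2) : C2 [⋀^Fin 2]→L[ℝ] ℂ :=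
  part11 (extDeriv (dbar ψ) x)

/-- A real `n`-form seen as a complex-valued one. -/
def complexify (α : C2 [⋀^Fin n]→L[ℝ] ℝ) : C2 [⋀^Fin n]→L[ℝ] ℂ :=
  Complex.ofRealCLM.compContinuousAlternatingMap α

/-- `|∇₀ᵏ T| = O(r^{-m-k})` along the filter `l`, for all `k ≥ 0`. The Levi-Civita connection `∇₀`
of the flat metric is the componentwise derivative, and the operator norm of `∇₀ᵏ T` is equivalent,
for each `k`, to the norm that the flat metric induces on tensors. -/
def HasDecay {W : Type*} [NormedAddCommGroup W] [NormedSpace ℝ W]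
    (l : Filter C2) (m : ℤ) (T : C2 → W) : Prop :=
  ∀ k : ℕ, Asymptotics.IsBigO l (fun x => iteratedFDeriv ℝ k T x)
    (fun x : C2 => ‖x‖ ^ (-m - (k : ℤ)))

end QuotientPotential

end

/-! Write E for the Euler field x and ξ = Ix for the generator of the circle action. Since i∂∂̄ψ =
-½ d(dψ∘I), it suffices to find an invariant decaying ψ for which b = γ + ½ dψ∘I is closed. Choose ψ
with dψ(E) = 2γ(ξ), so that b(ξ) = 0. This is a radial ODE whose decaying solution is ψ(x) = ∫₁^∞
f(tx) dt/t with f = -2γ(ξ). As γ = O(r⁻³), f = O(r⁻²) with matching derivatives; the integral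
converges, and ψ inherits invariance and decay (`hasDecay_radialIntegral`). Closedness
(`curl_eq_zero`): b is circle-invariant, so Cartan's formula gives ι_ξ db = -d(b(ξ)) = 0; since db
is of type (1,1), also ι_E db = 0. Hence L_E db = 0, so the coefficients of db are homogeneous of
degree -2 along rays. They are also O(r⁻⁴), so they vanish. -/

namespace QuotientPotential

open scoped ContDiff Topology
open MeasureTheory Filter Set Asymptotics

/-! ### Calculus of decay orders. -/

section Decay

variable {V W X : Type*} [NormedAddCommGroup V] [NormedSpace ℝ V] [NormedAddCommGroup W]
  [NormedSpace ℝ W] [NormedAddCommGroup X] [NormedSpace ℝ X] {l : Filter C2} {m m' : ℤ}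

/-- The complement of the closed ball of radius `ρ`; for `ρ = 0` it is the complement of `0`. -/
def exterior (ρ : ℝ) : Set C2 := {x | ρ < ‖x‖}

theorem exterior_zero : exterior 0 = {0}ᶜ := by
  ext x; simp [exterior]

theorem isOpen_exterior (ρ : ℝ) : IsOpen (exterior ρ) :=
  isOpen_lt continuous_const continuous_norm

theorem exterior_subset {ρ : ℝ} (hρ : 0 ≤ ρ) : exterior ρ ⊆ {0}ᶜ := fun _ hx =>
  norm_pos_iff.1 (hρ.trans_lt hx)

theorem exterior_mem_cobounded (ρ : ℝ) : exterior ρ ∈ Bornology.cobounded C2 :=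
  tendsto_norm_cobounded_atTop.eventually (eventually_gt_atTop ρ)

theorem cobounded_le_principal_compl_zero : Bornology.cobounded C2 ≤ 𝓟 ({0}ᶜ : Set C2) := by
  rw [← exterior_zero]; exact le_principal_iff.2 (exterior_mem_cobounded 0)

theorem smul_mem_exterior {ρ t : ℝ} (hρ : 0 ≤ ρ) (ht : 1 < t) {x : C2} (hx : x ∈ exterior ρ) :
    t • x ∈ exterior ρ := by
  simp only [exterior, mem_ofPred_eq, norm_smul, Real.norm_eq_abs, abs_of_pos (one_pos.trans ht)] at *
  nlinarith

theorem HasDecay.mono {l' : Filter C2} {T : C2 → W} (h : HasDecay l m T) (hl : l' ≤ l) :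
    HasDecay l' m T := fun k => (h k).mono hl

theorem HasDecay.isBigO {T : C2 → W} (h : HasDecay l m T) : T =O[l] fun x => ‖x‖ ^ (-m) := by
  have := (h 0).norm_left
  simpa [norm_iteratedFDeriv_zero] using this

theorem HasDecay.fderiv {T : C2 → W} (h : HasDecay l m T) : HasDecay l (m + 1) (fderiv ℝ T) := by
  intro k
  have := (h (k + 1)).norm_left
  simp only [← norm_iteratedFDeriv_fderiv] at this
  refine (isBigO_norm_left.1 this).congr_right fun x => ?_
  congr 1; push_cast; ring

theorem HasDecay.of_fderiv {T : C2 → W} (h0 : T =O[l] fun x => ‖x‖ ^ (-m))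
    (h : HasDecay l (m + 1) (_root_.fderiv ℝ T)) : HasDecay l m T := by
  rintro (_ | k)
  · rw [← isBigO_norm_left]
    simpa [norm_iteratedFDeriv_zero] using h0
  · rw [← isBigO_norm_left]
    simp only [← norm_iteratedFDeriv_fderiv]
    refine (h k).norm_left.congr_right fun x => ?_
    congr 1; push_cast; ring

/-- Leibniz rule: i derivatives on `S` and k - i on `T` give order (m + i) + (m' + k - i) = m + m' +
k, independent of i. -/
theorem HasDecay.bilinear (B : V →L[ℝ] W →L[ℝ] X) {S : C2 → V} {T : C2 → W}
    (hl : l ≤ 𝓟 {0}ᶜ) (hS : ContDiffOn ℝ ∞ S {0}ᶜ) (hT : ContDiffOn ℝ ∞ T {0}ᶜ)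
    (hdS : HasDecay l m S) (hdT : HasDecay l m' T) :
    HasDecay l (m + m') fun x => B (S x) (T x) := by
  intro k
  have h1 : (fun x => iteratedFDeriv ℝ k (fun x => B (S x) (T x)) x) =O[l] fun x =>
      ∑ i ∈ Finset.range (k + 1),
        ((k.choose i : ℝ) * ‖iteratedFDeriv ℝ i S x‖ * ‖iteratedFDeriv ℝ (k - i) T x‖) := by
    refine IsBigO.of_bound ‖B‖ (Eventually.filter_mono hl ?_)
    rw [eventually_principal]
    intro x hx
    have := B.norm_iteratedFDerivWithin_le_of_bilinear hS hT
      isOpen_compl_singleton.uniqueDiffOn hx (n := k) (by exact_mod_cast le_top)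
    simp only [iteratedFDerivWithin_of_isOpen _ isOpen_compl_singleton hx] at this
    exact this.trans (mul_le_mul_of_nonneg_left (le_abs_self _) B.opNorm_nonneg)
  refine h1.trans (IsBigO.fun_sum fun i hi => ?_)
  have h2 := ((hdS i).norm_left.const_mul_left (k.choose i : ℝ)).mul (hdT (k - i)).norm_left
  refine h2.trans_eventuallyEq (Eventually.filter_mono hl ?_)
  rw [eventually_principal]
  intro x hx
  have hx' : ‖x‖ ≠ 0 := norm_ne_zero_iff.2 hx
  have hi' : i ≤ k := Nat.lt_succ_iff.1 (Finset.mem_range.1 hi)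
  beta_reduce
  rw [← zpow_add₀ hx']
  congr 1; push_cast [hi']; ring

theorem hasDecay_zero : HasDecay l m (0 : C2 → W) := by
  intro k
  simp only [iteratedFDeriv_zero, Pi.zero_apply]
  exact isBigO_zero _ _

theorem hasDecay_linear (L : C2 →L[ℝ] W) : HasDecay l (-1) L := by
  refine HasDecay.of_fderiv ?_ (HasDecay.of_fderiv ?_ ?_)
  · simpa using (L.isBigO_id l).norm_right
  · have : _root_.fderiv ℝ (L : C2 → W) = fun _ => L := by ext1 y; simp
    rw [this]
    simpa using isBigO_const_const L (one_ne_zero (α := ℝ)) l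
  · have : _root_.fderiv ℝ (_root_.fderiv ℝ (L : C2 → W)) = 0 := by
      ext1 x
      have : _root_.fderiv ℝ (L : C2 → W) = fun _ => L := by ext1 y; simp
      rw [this]; simp
    rw [this]
    exact hasDecay_zero

theorem HasDecay.clm_comp (A : V →L[ℝ] W) {T : C2 → V} (hl : l ≤ 𝓟 {0}ᶜ)
    (hT : ContDiffOn ℝ ∞ T {0}ᶜ) (h : HasDecay l m T) : HasDecay l m fun x => A (T x) := by
  intro k
  refine IsBigO.trans (IsBigO.of_bound ‖A‖ (Eventually.filter_mono hl ?_)) (h k)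
  rw [eventually_principal]
  intro x hx
  have := A.iteratedFDeriv_comp_left (hT.contDiffAt (isOpen_compl_singleton.mem_nhds hx))
    (i := k) (by exact_mod_cast le_top)
  simp only [Function.comp_def] at this
  rw [this]
  exact A.norm_compContinuousMultilinearMap_le _

theorem continuousOn_iteratedFDeriv {T : C2 → W} (hT : ContDiffOn ℝ ∞ T {0}ᶜ) (k : ℕ) :
    ContinuousOn (iteratedFDeriv ℝ k T) {0}ᶜ :=
  (hT.continuousOn_iteratedFDerivWithin (m := k) (by exact_mod_cast le_top)
    isOpen_compl_singleton.uniqueDiffOn).congr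
    fun _ hx => (iteratedFDerivWithin_of_isOpen _ isOpen_compl_singleton hx).symm

/-- On every exterior domain of positive radius, decay at infinity is a uniform bound. -/
theorem HasDecay.exterior {T : C2 → W} (hT : ContDiffOn ℝ ∞ T {0}ᶜ)
    (h : HasDecay (Bornology.cobounded C2) m T) {ρ : ℝ} (hρ : 0 < ρ) :
    HasDecay (𝓟 (exterior ρ)) m T := by
  intro k
  obtain ⟨C, hC⟩ := (h k).bound
  obtain ⟨R, -, hR⟩ := (Metric.hasBasis_cobounded_compl_closedBall (0 : C2)).eventually_iff.1 hC
  -- Inside radius R the decay bound says nothing, but the closed shell between ρ and R is compact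
  -- and avoids 0, so continuity bounds the quotient there.
  have hK : IsCompact (Metric.closedBall (0 : C2) R \ Metric.ball 0 ρ) :=
    (isCompact_closedBall _ _).diff Metric.isOpen_ball
  have hK0 : Metric.closedBall (0 : C2) R \ Metric.ball 0 ρ ⊆ {0}ᶜ := by
    rintro x ⟨-, hx⟩ rfl
    exact hx (Metric.mem_ball_self hρ)
  have hcont : ContinuousOn (fun x => ‖iteratedFDeriv ℝ k T x‖ * (‖x‖ ^ (-m - (k : ℤ)))⁻¹)
      (Metric.closedBall (0 : C2) R \ Metric.ball 0 ρ) := by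
    refine ((continuousOn_iteratedFDeriv hT k).mono hK0).norm.mul (ContinuousOn.inv₀ ?_ ?_)
    · exact continuous_norm.continuousOn.zpow₀ _ fun x hx => Or.inl (norm_ne_zero_iff.2 (hK0 hx))
    · exact fun x hx => zpow_ne_zero _ (norm_ne_zero_iff.2 (hK0 hx))
  obtain ⟨D, hD⟩ := hK.bddAbove_image hcont
  rw [isBigO_principal]
  refine ⟨max C D, fun x hx => ?_⟩
  have hx0 : 0 < ‖x‖ := hρ.trans hx
  by_cases hxR : x ∈ Metric.closedBall (0 : C2) R
  · have h1 := hD (mem_image_of_mem _ (⟨hxR, fun h' => by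
      rw [mem_ball_zero_iff] at h'; exact lt_asymm h' hx⟩ :
      x ∈ Metric.closedBall (0 : C2) R \ Metric.ball 0 ρ))
    have h2 : 0 < ‖x‖ ^ (-m - (k : ℤ)) := zpow_pos hx0 _
    rw [← div_eq_mul_inv, div_le_iff₀ h2] at h1
    rw [Real.norm_of_nonneg h2.le]
    exact h1.trans (mul_le_mul_of_nonneg_right (le_max_right _ _) h2.le)
  · exact (hR hxR).trans (mul_le_mul_of_nonneg_right (le_max_left _ _) (norm_nonneg _))

end Decay

/-! ### Integration along outward rays. -/

section RadialIntegral

variable {W : Type} [NormedAddCommGroup W] [NormedSpace ℝ W] {j m : ℤ}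

/-- `∫₁^∞ tʲ T(t x) dt`. -/
noncomputable def radialIntegral (j : ℤ) (T : C2 → W) (x : C2) : W := ∫ t in Ioi (1 : ℝ), t ^ j • T (t • x)

theorem integrableOn_Ioi_zpow (hj : j < -1) : IntegrableOn (fun t : ℝ => t ^ j) (Ioi 1) := by
  have := integrableOn_Ioi_rpow_of_lt (a := (j : ℝ)) (by exact_mod_cast hj) one_pos
  simpa [Real.rpow_intCast] using this

/-- Outward rays stay in the exterior domain, and homogeneity of the bound pulls out t^(-m). The
majorant is integrable on (1, ∞) exactly when j + 1 < m. -/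
theorem norm_zpow_smul_le {T : C2 → W} {C ρ : ℝ} (hρ : 0 ≤ ρ)
    (hC : ∀ x ∈ exterior ρ, ‖T x‖ ≤ C * ‖‖x‖ ^ (-m)‖) {x : C2} (hx : x ∈ exterior ρ) {t : ℝ}
    (ht : 1 < t) : ‖t ^ j • T (t • x)‖ ≤ t ^ (j - m) * (C * ‖x‖ ^ (-m)) := by
  have ht0 : 0 < t := one_pos.trans ht
  have h := hC _ (smul_mem_exterior hρ ht hx)
  rw [norm_smul, Real.norm_of_nonneg (zpow_nonneg ht0.le j)]
  rw [norm_zpow, norm_norm, norm_smul, Real.norm_of_nonneg ht0.le, mul_zpow] at h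
  calc t ^ j * ‖T (t • x)‖ ≤ t ^ j * (C * (t ^ (-m) * ‖x‖ ^ (-m))) := by gcongr
    _ = t ^ (j - m) * (C * ‖x‖ ^ (-m)) := by
      rw [sub_eq_add_neg, zpow_add₀ ht0.ne']; ring

theorem continuousOn_zpow_smul {T : C2 → W} (hT : ContinuousOn T {0}ᶜ) {x : C2} (hx : x ≠ 0) :
    ContinuousOn (fun t : ℝ => t ^ j • T (t • x)) (Ioi 0) := by
  refine ContinuousOn.smul ?_ ?_
  · exact continuousOn_id.zpow₀ _ fun t ht => Or.inl (ne_of_gt ht)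
  · refine hT.comp (by fun_prop) fun t ht => ?_
    exact smul_ne_zero (ne_of_gt ht) hx

theorem aestronglyMeasurable_zpow_smul {T : C2 → W} (hT : ContinuousOn T {0}ᶜ) {x : C2}
    (hx : x ≠ 0) :
    AEStronglyMeasurable (fun t : ℝ => t ^ j • T (t • x)) (volume.restrict (Ioi 1)) :=
  ((continuousOn_zpow_smul hT hx).mono (Ioi_subset_Ioi zero_le_one)).aestronglyMeasurable
    measurableSet_Ioi

theorem integrableOn_zpow_smul {T : C2 → W} (hT : ContinuousOn T {0}ᶜ) (hjm : j + 1 < m) {ρ : ℝ}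
    (hρ : 0 ≤ ρ) (hd : T =O[𝓟 (exterior ρ)] fun x => ‖x‖ ^ (-m)) {x : C2} (hx : x ∈ exterior ρ) :
    IntegrableOn (fun t : ℝ => t ^ j • T (t • x)) (Ioi 1) := by
  obtain ⟨C, hC⟩ := isBigO_principal.1 hd
  refine ((integrableOn_Ioi_zpow (j := j - m) (by linarith)).mul_const (C * ‖x‖ ^ (-m))).mono'
    (aestronglyMeasurable_zpow_smul hT (exterior_subset hρ hx)) ?_
  exact (ae_restrict_mem measurableSet_Ioi).mono fun t ht => norm_zpow_smul_le hρ hC hx ht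

theorem isBigO_radialIntegral {T : C2 → W} (hjm : j + 1 < m) {ρ : ℝ}
    (hρ : 0 ≤ ρ) (hd : T =O[𝓟 (exterior ρ)] fun x => ‖x‖ ^ (-m)) :
    radialIntegral j T =O[𝓟 (exterior ρ)] fun x => ‖x‖ ^ (-m) := by
  obtain ⟨C, hC⟩ := isBigO_principal.1 hd
  rw [isBigO_principal]
  refine ⟨(∫ t in Ioi (1 : ℝ), t ^ (j - m)) * C, fun x hx => ?_⟩
  refine (norm_integral_le_of_norm_le
    ((integrableOn_Ioi_zpow (j := j - m) (by linarith)).mul_const (C * ‖x‖ ^ (-m)))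
    ((ae_restrict_mem measurableSet_Ioi).mono fun t ht => norm_zpow_smul_le hρ hC hx ht)).trans ?_
  rw [integral_mul_const, Real.norm_of_nonneg (by positivity), mul_assoc]

/-- Differentiation under the integral: the chain rule raises `j` by one and differentiation raises
the decay order by one, so the convergence condition is preserved and the statement can be iterated.
-/
theorem hasFDerivAt_radialIntegral {T : C2 → W} (hT : ContDiffOn ℝ ∞ T {0}ᶜ) (hm : 0 ≤ m)
    (hjm : j + 1 < m) (hd : ∀ ρ > 0, HasDecay (𝓟 (exterior ρ)) m T) {x : C2} (hx : x ≠ 0) :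
    HasFDerivAt (radialIntegral j T) (radialIntegral (j + 1) (fderiv ℝ T) x) x := by
  have hx' : 0 < ‖x‖ := norm_pos_iff.2 hx
  set ρ := ‖x‖ / 2 with hρdef
  have hρ : 0 < ρ := half_pos hx'
  have hxρ : x ∈ exterior ρ := half_lt_self hx'
  have hT' : ContinuousOn (fderiv ℝ T) {0}ᶜ :=
    ((contDiffOn_infty_iff_fderiv_of_isOpen isOpen_compl_singleton).1 hT).2.continuousOn
  obtain ⟨C, hC⟩ := isBigO_principal.1 (hd ρ hρ).fderiv.isBigO
  have hnhds : exterior ρ ∈ 𝓝 x := (isOpen_exterior ρ).mem_nhds hxρ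
  refine hasFDerivAt_integral_of_dominated_of_fderiv_le (μ := volume.restrict (Ioi (1 : ℝ)))
    (F' := fun y t => t ^ (j + 1) • fderiv ℝ T (t • y))
    (bound := fun t => t ^ (j - m) * (max C 0 * ρ ^ (-(m + 1)))) hnhds ?_ ?_ ?_ ?_ ?_ ?_
  · filter_upwards [hnhds] with y hy
    exact aestronglyMeasurable_zpow_smul hT.continuousOn (exterior_subset hρ.le hy)
  · exact integrableOn_zpow_smul hT.continuousOn hjm hρ.le (hd ρ hρ).isBigO hxρ
  · exact aestronglyMeasurable_zpow_smul hT' hx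
  · refine (ae_restrict_mem measurableSet_Ioi).mono fun t ht y hy => ?_
    refine (norm_zpow_smul_le hρ.le hC hy ht).trans ?_
    have ht0 : 0 < t := one_pos.trans ht
    -- Because m ≥ 0 the power is decreasing in the norm, so its value at ρ gives a majorant
    -- independent of y.
    have hle : ‖y‖ ^ (-(m + 1)) ≤ ρ ^ (-(m + 1)) := by
      rw [zpow_neg, zpow_neg]
      exact inv_anti₀ (zpow_pos hρ _) (zpow_le_zpow_left₀ (by linarith) hρ.le (le_of_lt hy))
    rw [add_sub_add_right_eq_sub]
    have hy0 : 0 < ‖y‖ := hρ.trans hy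
    gcongr
    exact le_max_left _ _
  · exact (integrableOn_Ioi_zpow (j := j - m) (by linarith)).mul_const _
  · refine (ae_restrict_mem measurableSet_Ioi).mono fun t ht y hy => ?_
    have ht0 : 0 < t := one_pos.trans ht
    have hty : t • y ∈ ({0}ᶜ : Set C2) := smul_ne_zero ht0.ne' (exterior_subset hρ.le hy)
    have h1 := ((hT.differentiableOn (by simp)).differentiableAt
      (isOpen_compl_singleton.mem_nhds hty)).hasFDerivAt
    have h2 : HasFDerivAt (fun y : C2 => t • y) (t • ContinuousLinearMap.id ℝ C2) y :=
      (hasFDerivAt_id y).const_smul t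
    refine ((h1.comp y h2).const_smul (t ^ j)).congr_fderiv ?_
    rw [zpow_add_one₀ ht0.ne']
    ext v
    simp [mul_smul]

theorem contDiffOn_radialIntegral {T : C2 → W} (hT : ContDiffOn ℝ ∞ T {0}ᶜ) (hm : 0 ≤ m)
    (hjm : j + 1 < m) (hd : ∀ ρ > 0, HasDecay (𝓟 (exterior ρ)) m T) :
    ContDiffOn ℝ ∞ (radialIntegral j T) {0}ᶜ := by
  rw [contDiffOn_infty]
  intro n
  -- The derivative is again a radial integral, with values in `C2 →L[ℝ] W` and with `j`, `m`
  -- shifted.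
  induction n generalizing W j m with
  | zero =>
    rw [Nat.cast_zero, contDiffOn_zero]
    exact fun x hx => (hasFDerivAt_radialIntegral hT hm hjm hd hx).continuousAt.continuousWithinAt
  | succ n ih =>
    rw [Nat.cast_succ, contDiffOn_succ_iff_fderiv_of_isOpen isOpen_compl_singleton]
    refine ⟨fun x hx => (hasFDerivAt_radialIntegral hT hm hjm hd
      hx).differentiableAt.differentiableWithinAt, by simp, ?_⟩
    refine (ih ((contDiffOn_infty_iff_fderiv_of_isOpen isOpen_compl_singleton).1 hT).2
      (m := m + 1) (j := j + 1) (by linarith) (by linarith) fun ρ hρ => (hd ρ hρ).fderiv).congr ?_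
    exact fun x hx => (hasFDerivAt_radialIntegral hT hm hjm hd hx).fderiv

/-- `hd` serves to differentiate under the integral, `hdρ` to estimate. Keeping them apart allows ρ
= 0, which yields the bounds on the whole punctured space. -/
theorem hasDecay_radialIntegral {T : C2 → W} (hT : ContDiffOn ℝ ∞ T {0}ᶜ) (hm : 0 ≤ m)
    (hjm : j + 1 < m) (hd : ∀ ρ > 0, HasDecay (𝓟 (exterior ρ)) m T) {ρ : ℝ} (hρ : 0 ≤ ρ)
    (hdρ : HasDecay (𝓟 (exterior ρ)) m T) :
    HasDecay (𝓟 (exterior ρ)) m (radialIntegral j T) := by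
  intro k
  induction k generalizing W j m with
  | zero =>
    rw [← isBigO_norm_left]
    simpa [norm_iteratedFDeriv_zero] using isBigO_radialIntegral hjm hρ hdρ.isBigO
  | succ k ih =>
    rw [← isBigO_norm_left]
    simp only [← norm_iteratedFDeriv_fderiv]
    have h := ih ((contDiffOn_infty_iff_fderiv_of_isOpen isOpen_compl_singleton).1 hT).2
      (m := m + 1) (j := j + 1) (by linarith) (by linarith) (fun ρ hρ => (hd ρ hρ).fderiv)
      hdρ.fderiv
    refine (h.congr' ?_ (EventuallyEq.of_eq ?_)).norm_left
    · refine eventually_principal.2 fun x hx => ?_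
      have heq : EqOn (radialIntegral (j + 1) (fderiv ℝ T)) (fderiv ℝ (radialIntegral j T)) {0}ᶜ :=
        fun x hx => (hasFDerivAt_radialIntegral hT hm hjm hd hx).fderiv.symm
      exact ((heq.eventuallyEq_of_mem (isOpen_compl_singleton.mem_nhds
        (exterior_subset hρ hx))).iteratedFDeriv ℝ k).eq_of_nhds
    · ext x
      congr 1; push_cast; ring

/-- The radial integral inverts the Euler vector field: `E (∫₁^∞ T(t x) dt / t) = -T(x)`. -/
theorem radialIntegral_fderiv_apply_self [CompleteSpace W] {T : C2 → W}
    (hT : ContDiffOn ℝ ∞ T {0}ᶜ) (hm : 0 < m)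
    (hd : ∀ ρ > 0, HasDecay (𝓟 (exterior ρ)) m T) {x : C2} (hx : x ≠ 0) :
    radialIntegral 0 (fderiv ℝ T) x x = -T x := by
  have hx' : 0 < ‖x‖ := norm_pos_iff.2 hx
  have hT' : ContinuousOn (fderiv ℝ T) {0}ᶜ :=
    ((contDiffOn_infty_iff_fderiv_of_isOpen isOpen_compl_singleton).1 hT).2.continuousOn
  have hxρ : x ∈ exterior (‖x‖ / 2) := half_lt_self hx'
  have hint : IntegrableOn (fun t : ℝ => t ^ (0 : ℤ) • fderiv ℝ T (t • x)) (Ioi 1) :=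
    integrableOn_zpow_smul hT' (m := m + 1) (by linarith) (half_pos hx').le
      (hd _ (half_pos hx')).fderiv.isBigO hxρ
  have hderiv : ∀ t : ℝ, 0 < t → HasDerivAt (fun t : ℝ => T (t • x)) (fderiv ℝ T (t • x) x) t := by
    intro t ht
    have hty : t • x ∈ ({0}ᶜ : Set C2) := smul_ne_zero ht.ne' hx
    have h1 := ((hT.differentiableOn (by simp)).differentiableAt
      (isOpen_compl_singleton.mem_nhds hty)).hasFDerivAt
    have h2 : HasDerivAt (fun t : ℝ => t • x) x t := by
      simpa using (hasDerivAt_id t).smul_const x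
    exact h1.comp_hasDerivAt t h2
  have htend : Tendsto (fun t : ℝ => T (t • x)) atTop (𝓝 0) := by
    have hn : Tendsto (fun t : ℝ => ‖t • x‖) atTop atTop := by
      simp only [norm_smul]
      exact (tendsto_norm_atTop_atTop).atTop_mul_const hx'
    have hz : Tendsto (fun t : ℝ => ‖t • x‖ ^ (-m)) atTop (𝓝 0) :=
      (tendsto_zpow_atTop_zero (by linarith)).comp hn
    have hc := (hd 1 one_pos).isBigO.comp_tendsto (k := fun t : ℝ => t • x) (l' := atTop)
      (tendsto_principal.2 (hn.eventually (eventually_gt_atTop 1)))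
    exact hc.trans_tendsto hz
  -- Fundamental theorem of calculus for t ↦ T(tx), which tends to 0 since m > 0.
  have key := integral_Ioi_of_hasDerivAt_of_tendsto (a := 1)
    (hderiv 1 one_pos).continuousAt.continuousWithinAt
    (fun t ht => hderiv t (one_pos.trans ht))
    (by simpa [IntegrableOn] using hint.apply_continuousLinearMap x) htend
  rw [radialIntegral, ContinuousLinearMap.integral_apply hint]
  simpa using key

end RadialIntegral

/-! ### Circle action, Cartan calculus and closedness. -/

theorem scalarAct_apply (c : ℂ) (x : C2) : scalarAct c x = c • x := rfl

theorem scalarAct_I_scalarAct_I (x : C2) :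
    scalarAct Complex.I (scalarAct Complex.I x) = -x := by
  simp [scalarAct_apply, smul_smul]

theorem scalarAct_comm (c d : ℂ) (x : C2) :
    scalarAct c (scalarAct d x) = scalarAct d (scalarAct c x) := by
  simp [scalarAct_apply, smul_smul, mul_comm]

theorem scalarAct_ne_zero {c : ℂ} (hc : ‖c‖ = 1) {x : C2} (hx : x ≠ 0) : scalarAct c x ≠ 0 := by
  have hc0 : c ≠ 0 := norm_ne_zero_iff.1 (by rw [hc]; exact one_ne_zero)
  exact smul_ne_zero hc0 hx

section Curl

variable {F : Type*} [NormedAddCommGroup F] [NormedSpace ℝ F]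

theorem extDeriv_ofSubsingleton {a : C2 → C2 →L[ℝ] F} {x : C2} (ha : DifferentiableAt ℝ a x)
    (v : Fin 2 → C2) :
    extDeriv (fun y => ContinuousAlternatingMap.ofSubsingleton ℝ C2 F (0 : Fin 1) (a y)) x v =
      fderiv ℝ a x (v 0) (v 1) - fderiv ℝ a x (v 1) (v 0) := by
  have h := ((ContinuousAlternatingMap.ofSubsingletonLIE (𝕜 := ℝ) (E := C2) (F := F)
    (0 : Fin 1)).toContinuousLinearEquiv.hasFDerivAt (x := a x)).comp x ha.hasFDerivAt
  have h' : fderiv ℝ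
      (fun y => ContinuousAlternatingMap.ofSubsingleton ℝ C2 F (0 : Fin 1) (a y)) x = _ := h.fderiv
  rw [extDeriv, h', ContinuousAlternatingMap.alternatizeUncurryFin_apply]
  simp [Fin.sum_univ_two, Fin.removeNth, sub_eq_add_neg]

end Curl

theorem hasDerivAt_apply_curve {E : Type*} [NormedAddCommGroup E] [NormedSpace ℝ E]
    {b : E → E →L[ℝ] ℝ} {b' : E →L[ℝ] E →L[ℝ] ℝ} {p q : ℝ → E} {p' q' : E} {t : ℝ}
    (hb : HasFDerivAt b b' (p t)) (hp : HasDerivAt p p' t) (hq : HasDerivAt q q' t) :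
    HasDerivAt (fun s => b (p s) (q s)) (b' p' (q t) + b (p t) q') t :=
  (hb.comp_hasDerivAt t hp).clm_apply hq

/-- Infinitesimal invariance L_ξ b = 0, from differentiating the action of exp(iθ) at θ = 0. -/
theorem fderiv_rotation {b : C2 → C2 →L[ℝ] ℝ} {x : C2} (hb : DifferentiableAt ℝ b x)
    (hrot : ∀ c : ℂ, ‖c‖ = 1 → ∀ v, b (scalarAct c x) (scalarAct c v) = b x v) (v : C2) :
    fderiv ℝ b x (scalarAct Complex.I x) v + b x (scalarAct Complex.I v) = 0 := by
  have hexp : HasDerivAt (fun θ : ℝ => Complex.exp (θ * Complex.I)) Complex.I 0 := by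
    have := ((Complex.ofRealCLM.hasDerivAt (x := 0)).mul_const Complex.I).cexp
    simpa using this
  have hcurve : ∀ w : C2, HasDerivAt (fun θ : ℝ => scalarAct (Complex.exp (θ * Complex.I)) w)
      (scalarAct Complex.I w) 0 := by
    intro w
    have := hexp.smul_const w
    simpa only [scalarAct_apply] using this
  have h0 : ∀ w : C2, scalarAct (Complex.exp (((0 : ℝ) : ℂ) * Complex.I)) w = w := by
    simp [scalarAct_apply]
  have hb' : HasFDerivAt b (fderiv ℝ b x)
      (scalarAct (Complex.exp (((0 : ℝ) : ℂ) * Complex.I)) x) := by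
    rw [h0]; exact hb.hasFDerivAt
  have h := hasDerivAt_apply_curve hb' (hcurve x) (hcurve v)
  rw [h0, h0] at h
  have hc : HasDerivAt (fun θ : ℝ => b (scalarAct (Complex.exp (θ * Complex.I)) x)
      (scalarAct (Complex.exp (θ * Complex.I)) v)) 0 0 := by
    simp only [hrot _ (Complex.norm_exp_ofReal_mul_I _)]
    exact hasDerivAt_const _ _
  exact h.unique hc

/-- A closed `2`-form `db` that is annihilated by the Euler vector field and decays faster than
`r⁻²` vanishes. -/
theorem curl_eq_zero_of_euler {b : C2 → C2 →L[ℝ] ℝ} (hb : ContDiffOn ℝ ∞ b {0}ᶜ)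
    (hE : ∀ x : C2, x ≠ 0 → ∀ v, fderiv ℝ b x x v = fderiv ℝ b x v x)
    (hd : (fun x => ‖fderiv ℝ b x‖) =O[Bornology.cobounded C2] fun x => ‖x‖ ^ (-4 : ℤ)) {x : C2} (hx : x ≠ 0)
    (u v : C2) : fderiv ℝ b x u v = fderiv ℝ b x v u := by
  have hopen : IsOpen ({0}ᶜ : Set C2) := isOpen_compl_singleton
  have hb1 : ContDiffOn ℝ ∞ (fderiv ℝ b) {0}ᶜ :=
    ((contDiffOn_infty_iff_fderiv_of_isOpen hopen).1 hb).2
  have hD : ∀ y : C2, y ≠ 0 → HasFDerivAt (fderiv ℝ b) (fderiv ℝ (fderiv ℝ b) y) y := fun y hy =>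
    ((hb1.differentiableOn (by simp)).differentiableAt (hopen.mem_nhds hy)).hasFDerivAt
  have hDa : ∀ y : C2, y ≠ 0 → ∀ p q : C2, HasFDerivAt (fun z => fderiv ℝ b z p q)
      (((fderiv ℝ (fderiv ℝ b) y).flip p).flip q) y := by
    intro y hy p q
    refine (((hD y hy).clm_apply (hasFDerivAt_const p y)).clm_apply
      (hasFDerivAt_const q y)).congr_fderiv ?_
    ext w
    simp
  have hsymm : ∀ y : C2, y ≠ 0 → ∀ p q,
      fderiv ℝ (fderiv ℝ b) y p q = fderiv ℝ (fderiv ℝ b) y q p := fun y hy p q =>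
    (hb.contDiffAt (hopen.mem_nhds hy)).isSymmSndFDerivAt
      (by rw [minSmoothness_of_isRCLikeNormedField]; exact ENat.LEInfty.out) p q
  -- The identity ι_E db = 0 differentiated in direction p.
  have hdE : ∀ y : C2, y ≠ 0 → ∀ p q : C2,
      fderiv ℝ (fderiv ℝ b) y p y q + fderiv ℝ b y p q =
        fderiv ℝ (fderiv ℝ b) y p q y + fderiv ℝ b y q p := by
    intro y hy p q
    have h1 := ((hD y hy).clm_apply (hasFDerivAt_id y)).clm_apply (hasFDerivAt_const q y)
    have h2 := ((hD y hy).clm_apply (hasFDerivAt_const q y)).clm_apply (hasFDerivAt_id y)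
    have h3 := h1.unique (h2.congr_of_eventuallyEq
      (Filter.eventuallyEq_of_mem (hopen.mem_nhds hy) fun z hz => hE z hz q))
    have h4 := congrArg (fun A => A p) h3
    simp at h4
    linarith
  -- Antisymmetrizing in u, v and using symmetry of second derivatives of b gives L_E db = 0 in
  -- coordinates.
  have hLie : ∀ y : C2, y ≠ 0 → fderiv ℝ (fderiv ℝ b) y y u v - fderiv ℝ (fderiv ℝ b) y y v u =
      -2 * (fderiv ℝ b y u v - fderiv ℝ b y v u) := by
    intro y hy
    have h1 := hdE y hy u v
    have h2 := hdE y hy v u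
    rw [hsymm y hy u y, hsymm y hy u v] at h1
    rw [hsymm y hy v y] at h2
    linarith
  -- The factor t² cancels the degree -2 homogeneity, so φ is constant.
  set φ : ℝ → ℝ := fun t => t ^ 2 * (fderiv ℝ b (t • x) u v - fderiv ℝ b (t • x) v u) with hφ
  have hφd : ∀ t ∈ Ioi (0 : ℝ), HasDerivAt φ 0 t := by
    intro t ht
    have ht0 : t ≠ 0 := ne_of_gt ht
    have hy : t • x ≠ 0 := smul_ne_zero ht0 hx
    have hc : HasDerivAt (fun t : ℝ => t • x) x t := by
      simpa using (hasDerivAt_id t).smul_const x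
    have huv := (hDa _ hy u v).comp_hasDerivAt t hc
    have hvu := (hDa _ hy v u).comp_hasDerivAt t hc
    refine ((hasDerivAt_pow 2 t).mul (huv.sub hvu)).congr_deriv ?_
    have h2 := hLie _ hy
    simp only [map_smul, smul_apply, smul_eq_mul] at h2
    simp
    linear_combination t * h2
  have hconst : ∀ t ∈ Ioi (0 : ℝ), φ t = φ 1 := fun t ht =>
    isOpen_Ioi.is_const_of_deriv_eq_zero isPreconnected_Ioi
      (fun s hs => (hφd s hs).differentiableAt.differentiableWithinAt)
      (fun s hs => (hφd s hs).deriv) ht (mem_Ioi.2 one_pos)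
  have hx' : 0 < ‖x‖ := norm_pos_iff.2 hx
  have hn : Tendsto (fun t : ℝ => t • x) atTop (Bornology.cobounded C2) := by
    rw [← tendsto_norm_atTop_iff_cobounded]
    simp only [norm_smul]
    exact (tendsto_norm_atTop_atTop).atTop_mul_const hx'
  have hφlim : Tendsto φ atTop (𝓝 0) := by
    have happ : ∀ p q : C2, Tendsto (fun t : ℝ => t ^ 2 * fderiv ℝ b (t • x) p q) atTop (𝓝 0) := by
      intro p q
      have hpq : (fun y => fderiv ℝ b y p q) =O[Bornology.cobounded C2]
          fun y => ‖y‖ ^ (-4 : ℤ) := by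
        refine IsBigO.trans (IsBigO.of_bound (‖p‖ * ‖q‖) (Eventually.of_forall fun y => ?_))
          hd
        rw [Real.norm_of_nonneg (fderiv ℝ b y).opNorm_nonneg]
        calc ‖fderiv ℝ b y p q‖ ≤ ‖fderiv ℝ b y‖ * ‖p‖ * ‖q‖ := (fderiv ℝ b y).le_opNorm₂ p q
          _ = ‖p‖ * ‖q‖ * ‖fderiv ℝ b y‖ := by ring
      have h1 := (isBigO_refl (fun t : ℝ => t ^ 2) atTop).mul (hpq.comp_tendsto hn)
      refine h1.trans_tendsto ?_
      -- Decay of order 4 beats the weight t², leaving t⁻².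
      have h2 : Tendsto (fun t : ℝ => t ^ (-2 : ℤ) * ‖x‖ ^ (-4 : ℤ)) atTop (𝓝 (0 * _)) :=
        (tendsto_zpow_atTop_zero (by norm_num)).mul_const _
      rw [zero_mul] at h2
      refine h2.congr' ?_
      filter_upwards [eventually_gt_atTop 0] with t ht
      simp only [Function.comp_apply, norm_smul, Real.norm_of_nonneg ht.le, mul_zpow]
      rw [← mul_assoc, ← zpow_natCast, ← zpow_add₀ ht.ne']
      norm_num
    have := (happ u v).sub (happ v u)
    simpa [hφ, mul_sub] using this
  have hφ1 : φ 1 = 0 := tendsto_nhds_unique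
    (tendsto_const_nhds.congr' ((eventually_gt_atTop (0 : ℝ)).mono fun t ht => (hconst t ht).symm))
    hφlim
  simpa [hφ, sub_eq_zero] using hφ1

/-- A rotation-invariant `1`-form `b` annihilated by the generator of the rotations whose
differential is a decaying `(1,1)`-form is closed. -/
theorem curl_eq_zero {b : C2 → C2 →L[ℝ] ℝ} (hb : ContDiffOn ℝ ∞ b {0}ᶜ)
    (h11 : ∀ x : C2, x ≠ 0 → ∀ u v,
      fderiv ℝ b x (scalarAct Complex.I u) (scalarAct Complex.I v) -
        fderiv ℝ b x (scalarAct Complex.I v) (scalarAct Complex.I u) =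
      fderiv ℝ b x u v - fderiv ℝ b x v u)
    (hrot : ∀ c : ℂ, ‖c‖ = 1 → ∀ x : C2, x ≠ 0 → ∀ v,
      b (scalarAct c x) (scalarAct c v) = b x v)
    (hgen : ∀ x : C2, x ≠ 0 → b x (scalarAct Complex.I x) = 0)
    (hd : (fun x => ‖fderiv ℝ b x‖) =O[Bornology.cobounded C2] fun x => ‖x‖ ^ (-4 : ℤ)) {x : C2} (hx : x ≠ 0)
    (u v : C2) : fderiv ℝ b x u v = fderiv ℝ b x v u := by
  refine curl_eq_zero_of_euler hb (fun y hy w => ?_) hd hx u v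
  have hby : DifferentiableAt ℝ b y :=
    (hb.differentiableOn (by simp)).differentiableAt (isOpen_compl_singleton.mem_nhds hy)
  have h1 := fderiv_rotation hby (fun c hc => hrot c hc y hy) (scalarAct Complex.I w)
  have h2 := (hby.hasFDerivAt.clm_apply (scalarAct Complex.I).hasFDerivAt).unique
    ((hasFDerivAt_const (0 : ℝ) y).congr_of_eventuallyEq
      (Filter.eventuallyEq_of_mem (isOpen_compl_singleton.mem_nhds hy) fun z hz => hgen z hz))
  have h3 := congrArg (fun A => A (scalarAct Complex.I w)) h2
  simp at h3
  -- `h1` (invariance) and `h3` (derivative of b(ξ) = 0) together say db(Iy, Iw) = 0; type (1,1)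
  -- turns this into db(y, w) = 0.
  have h4 := h11 y hy y w
  linarith

theorem radialIntegral_comp_of_invariant {W : Type} [NormedAddCommGroup W] [NormedSpace ℝ W]
    (j : ℤ) {T : C2 → W} (L : C2 →L[ℝ] C2) (hT : ∀ x : C2, x ≠ 0 → T (L x) = T x) {x : C2}
    (hx : x ≠ 0) : radialIntegral j T (L x) = radialIntegral j T x := by
  refine setIntegral_congr_fun measurableSet_Ioi fun t ht => ?_
  beta_reduce
  rw [← map_smul, hT _ (smul_ne_zero (one_pos.trans ht).ne' hx)]

/-! ### The form i∂∂̄ψ in terms of the real Hessian. -/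

/-- `∂̄ψ` as a linear function of `dψ`. -/
noncomputable def dbarCLM : (C2 →L[ℝ] ℝ) →L[ℝ] (C2 →L[ℝ] ℂ) :=
  (2⁻¹ : ℝ) • (ContinuousLinearMap.compL ℝ C2 ℝ ℂ Complex.ofRealCLM +
    Complex.I • (ContinuousLinearMap.compL ℝ C2 ℝ ℂ Complex.ofRealCLM).comp
      ((ContinuousLinearMap.compL ℝ C2 C2 ℝ).flip (scalarAct Complex.I)))

theorem dbar_eq (ψ : C2 → ℝ) : dbar ψ = fun x =>
    ContinuousAlternatingMap.ofSubsingleton ℝ C2 ℂ (0 : Fin 1) (dbarCLM (fderiv ℝ ψ x)) := rfl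

/-- This is i∂∂̄ψ = -½ d(dψ∘I). The real part of d(∂̄ψ) is ½ d(dψ) = 0, and the remaining part is
already of type (1,1), so `part11` leaves it unchanged. -/
theorem I_smul_ddbar_apply {ψ : C2 → ℝ} (hψ : ContDiffOn ℝ ∞ ψ {0}ᶜ) {x : C2} (hx : x ≠ 0)
    (v : Fin 2 → C2) : (Complex.I • ddbar ψ x) v =
      ((-2⁻¹ * (fderiv ℝ (fderiv ℝ ψ) x (v 0) (scalarAct Complex.I (v 1)) -
        fderiv ℝ (fderiv ℝ ψ) x (v 1) (scalarAct Complex.I (v 0))) : ℝ) : ℂ) := by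
  have hopen : IsOpen ({0}ᶜ : Set C2) := isOpen_compl_singleton
  have hψ1 : DifferentiableAt ℝ (fderiv ℝ ψ) x :=
    (((contDiffOn_infty_iff_fderiv_of_isOpen hopen).1 hψ).2.differentiableOn
      (by simp)).differentiableAt (hopen.mem_nhds hx)
  have hsymm : ∀ p q, fderiv ℝ (fderiv ℝ ψ) x p q = fderiv ℝ (fderiv ℝ ψ) x q p := fun p q =>
    (hψ.contDiffAt (hopen.mem_nhds hx)).isSymmSndFDerivAt
      (by rw [minSmoothness_of_isRCLikeNormedField]; exact ENat.LEInfty.out) p q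
  have hA : HasFDerivAt (fun y => dbarCLM (fderiv ℝ ψ y))
      (dbarCLM.comp (fderiv ℝ (fderiv ℝ ψ) x)) x := dbarCLM.hasFDerivAt.comp x hψ1.hasFDerivAt
  have hext : ∀ w : Fin 2 → C2, extDeriv (dbar ψ) x w = (2⁻¹ : ℝ) • (Complex.I *
      ((fderiv ℝ (fderiv ℝ ψ) x (w 0) (scalarAct Complex.I (w 1)) -
        fderiv ℝ (fderiv ℝ ψ) x (w 1) (scalarAct Complex.I (w 0)) : ℝ) : ℂ)) := by
    intro w
    rw [dbar_eq, extDeriv_ofSubsingleton hA.differentiableAt, hA.fderiv]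
    simp [dbarCLM, hsymm (w 1) (w 0)]
    ring
  have hI : Complex.I * Complex.I = -1 := Complex.I_mul_I
  simp only [ddbar, part11, ContinuousAlternatingMap.smul_apply, ContinuousAlternatingMap.add_apply,
    ContinuousAlternatingMap.compContinuousLinearMap_apply, hext, Function.comp_apply,
    scalarAct_I_scalarAct_I, map_neg, hsymm (scalarAct Complex.I (v 0)),
    hsymm (scalarAct Complex.I (v 1))]
  simp
  linear_combination (2⁻¹ * ((fderiv ℝ (fderiv ℝ ψ) x (v 0) (scalarAct Complex.I (v 1)) : ℂ) -
        fderiv ℝ (fderiv ℝ ψ) x (v 1) (scalarAct Complex.I (v 0)))) * hI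

end QuotientPotential

/-! ### The theorem. -/

open scoped ContDiff Topology
open MeasureTheory Filter Set Asymptotics

open QuotientPotential in
theorem proposition4p3
    (Γ : Subgroup (Matrix.specialUnitaryGroup (Fin 2) ℂ)) [Finite Γ]
    (γ : C2 → C2 [⋀^Fin 1]→L[ℝ] ℝ)
    (hγ : IsSmoothForm Γ γ) (hS : IsCircleInvariantForm γ)
    (h11 : IsType11 (extDeriv γ))
    (hdecay : HasDecay (Bornology.cobounded C2) 3 γ) :
    ∃ ψ : C2 → ℝ, IsSmoothFunction Γ ψ ∧ IsCircleInvariantFunction ψ ∧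
      (∀ x : C2, x ≠ 0 → complexify (extDeriv γ x) = Complex.I • ddbar ψ x) ∧
      HasDecay (Bornology.cobounded C2) 2 ψ ∧
      (HasDecay (Filter.principal {0}ᶜ) 3 γ → HasDecay (Filter.principal {0}ᶜ) 2 ψ) := by
  have hopen : IsOpen ({0}ᶜ : Set C2) := isOpen_compl_singleton
  let Λ := (ContinuousAlternatingMap.ofSubsingletonLIE (𝕜 := ℝ) (E := C2) (F := ℝ)
    (0 : Fin 1)).symm.toContinuousLinearEquiv.toContinuousLinearMap
  set a : C2 → C2 →L[ℝ] ℝ := fun x => Λ (γ x)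
  have hγa : γ = fun x => ContinuousAlternatingMap.ofSubsingleton ℝ C2 ℝ (0 : Fin 1) (a x) := by
    funext x
    exact ((ContinuousAlternatingMap.ofSubsingleton ℝ C2 ℝ (0 : Fin 1)).apply_symm_apply (γ x)).symm
  have ha : ContDiffOn ℝ ∞ a {0}ᶜ := Λ.contDiff.comp_contDiffOn hγ.1
  have ha1 : ∀ x : C2, x ≠ 0 → DifferentiableAt ℝ a x := fun x hx =>
    (ha.differentiableOn (by simp)).differentiableAt (hopen.mem_nhds hx)
  have ha_pull : ∀ (L : C2 →L[ℝ] C2) (x : C2), pullback L γ x = γ x →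
      ∀ v, a (L x) (L v) = a x v := fun L x h v => by
    have := congrArg (fun β => β (fun _ => v)) h
    exact this
  -- the function `-2 γ(I x)` and its radial integral
  set B : (C2 →L[ℝ] ℝ) →L[ℝ] C2 →L[ℝ] ℝ := (-2 : ℝ) • ContinuousLinearMap.id ℝ _ with hB
  set f : C2 → ℝ := fun x => B (a x) (scalarAct Complex.I x) with hf_def
  have hf_apply : ∀ x, f x = -2 * a x (scalarAct Complex.I x) := fun x => by simp [hf_def, hB]
  have hf : ContDiffOn ℝ ∞ f {0}ᶜ :=
    (B.contDiff.comp_contDiffOn ha).clm_apply (scalarAct Complex.I).contDiff.contDiffOn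
  have hf_decay : ∀ l : Filter C2, l ≤ 𝓟 {0}ᶜ → HasDecay l 3 γ → HasDecay l 2 f := by
    intro l hl h
    have := HasDecay.bilinear B hl ha (scalarAct Complex.I).contDiff.contDiffOn
      (h.clm_comp Λ hl hγ.1) (hasDecay_linear (scalarAct Complex.I))
    exact this
  have hf_ext : ∀ ρ > 0, HasDecay (𝓟 (exterior ρ)) 2 f := fun ρ hρ =>
    (hf_decay _ cobounded_le_principal_compl_zero hdecay).exterior hf hρ
  have hf_inv : ∀ L : C2 →L[ℝ] C2, (∀ x, L (scalarAct Complex.I x) = scalarAct Complex.I (L x)) →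
      (∀ x : C2, x ≠ 0 → pullback L γ x = γ x) → ∀ x : C2, x ≠ 0 → f (L x) = f x := by
    intro L hL h x hx
    rw [hf_apply, hf_apply, ← hL, ha_pull L x (h x hx)]
  set ψ : C2 → ℝ := radialIntegral (-1) f
  have hψ : ContDiffOn ℝ ∞ ψ {0}ᶜ :=
    contDiffOn_radialIntegral hf (by norm_num) (by norm_num) hf_ext
  have hψ' : ContDiffOn ℝ ∞ (fderiv ℝ ψ) {0}ᶜ :=
    ((contDiffOn_infty_iff_fderiv_of_isOpen hopen).1 hψ).2
  have hψ_ext : ∀ ρ : ℝ, 0 ≤ ρ → HasDecay (𝓟 (exterior ρ)) 2 f →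
      HasDecay (𝓟 (exterior ρ)) 2 ψ := fun ρ hρ h =>
    hasDecay_radialIntegral hf (by norm_num) (by norm_num) hf_ext hρ h
  have hψ_decay : HasDecay (Bornology.cobounded C2) 2 ψ :=
    (hψ_ext 1 zero_le_one (hf_ext 1 one_pos)).mono
      (le_principal_iff.2 (exterior_mem_cobounded 1))
  have hψ_circle : IsCircleInvariantFunction ψ := fun c hc x hx =>
    radialIntegral_comp_of_invariant _ _
      (hf_inv _ (fun y => scalarAct_comm _ _ _) fun y hy => hS c hc y hy) hx
  have hψ_euler : ∀ x : C2, x ≠ 0 → fderiv ℝ ψ x x = 2 * a x (scalarAct Complex.I x) := by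
    intro x hx
    have h1 : fderiv ℝ ψ x = radialIntegral 0 (fderiv ℝ f) x :=
      (hasFDerivAt_radialIntegral (j := -1) hf (m := 2) (by norm_num) (by norm_num) hf_ext hx).fderiv
    rw [h1, radialIntegral_fderiv_apply_self hf (m := 2) (by norm_num) hf_ext hx, hf_apply]
    ring
  have hψ_rot : ∀ c : ℂ, ‖c‖ = 1 → ∀ x : C2, x ≠ 0 → ∀ v,
      fderiv ℝ ψ (scalarAct c x) (scalarAct c v) = fderiv ℝ ψ x v := by
    intro c hc x hx v
    have h1 := ((hψ.differentiableOn (by simp)).differentiableAt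
      (hopen.mem_nhds (scalarAct_ne_zero hc hx))).hasFDerivAt.comp x (scalarAct c).hasFDerivAt
    have h2 := h1.congr_of_eventuallyEq (f₁ := ψ) (Filter.eventuallyEq_of_mem (hopen.mem_nhds hx)
      fun z hz => (hψ_circle c hc z hz).symm)
    rw [h2.fderiv]
    rfl
  -- the form `γ + ½ dψ ∘ I` is closed
  set K : (C2 →L[ℝ] ℝ) →L[ℝ] C2 →L[ℝ] ℝ :=
    (2⁻¹ : ℝ) • (ContinuousLinearMap.compL ℝ C2 C2 ℝ).flip (scalarAct Complex.I) with hK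
  set b : C2 → C2 →L[ℝ] ℝ := fun x => a x + K (fderiv ℝ ψ x) with hb_def
  have hb_apply : ∀ x v, b x v = a x v + 2⁻¹ * fderiv ℝ ψ x (scalarAct Complex.I v) :=
    fun x v => by simp [hb_def, hK]
  have hb : ContDiffOn ℝ ∞ b {0}ᶜ := ha.add (K.contDiff.comp_contDiffOn hψ')
  have hbD : ∀ x : C2, x ≠ 0 →
      HasFDerivAt b (fderiv ℝ a x + K.comp (fderiv ℝ (fderiv ℝ ψ) x)) x := fun x hx =>
    (ha1 x hx).hasFDerivAt.add (K.hasFDerivAt.comp x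
      ((hψ'.differentiableOn (by simp)).differentiableAt (hopen.mem_nhds hx)).hasFDerivAt)
  have hbD_apply : ∀ x : C2, x ≠ 0 → ∀ u v, fderiv ℝ b x u v =
      fderiv ℝ a x u v + 2⁻¹ * fderiv ℝ (fderiv ℝ ψ) x u (scalarAct Complex.I v) := by
    intro x hx u v
    rw [(hbD x hx).fderiv]
    simp [hK]
  have hsymm : ∀ x : C2, x ≠ 0 → ∀ p q,
      fderiv ℝ (fderiv ℝ ψ) x p q = fderiv ℝ (fderiv ℝ ψ) x q p := fun x hx p q =>
    (hψ.contDiffAt (hopen.mem_nhds hx)).isSymmSndFDerivAt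
      (by rw [minSmoothness_of_isRCLikeNormedField]; exact ENat.LEInfty.out) p q
  have ha_ext : ∀ x : C2, x ≠ 0 → ∀ w : Fin 2 → C2, extDeriv γ x w =
      fderiv ℝ a x (w 0) (w 1) - fderiv ℝ a x (w 1) (w 0) := by
    intro x hx w
    conv_lhs => rw [hγa]
    exact extDeriv_ofSubsingleton (ha1 x hx) w
  have hclosed : ∀ x : C2, x ≠ 0 → ∀ u v, fderiv ℝ b x u v = fderiv ℝ b x v u := by
    intro x hx u v
    refine curl_eq_zero hb ?_ ?_ ?_ ?_ hx u v
    · intro y hy p q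
      have h1 := congrArg (fun β => β ![p, q]) (h11 y hy)
      simp only [ContinuousAlternatingMap.compContinuousLinearMap_apply, ha_ext y hy] at h1
      simp at h1
      simp only [hbD_apply y hy, scalarAct_I_scalarAct_I, map_neg]
      -- The Hessian terms are I-invariant after antisymmetrization, so only the hypothesis on dγ is
      -- needed.
      rw [hsymm y hy (scalarAct Complex.I p) q, hsymm y hy (scalarAct Complex.I q) p]
      linarith
    · intro c hc y hy v
      rw [hb_apply, hb_apply, ha_pull _ _ (hS c hc y hy), scalarAct_comm, hψ_rot c hc y hy]
    · intro y hy
      -- The factor -2 in `f` is chosen for this cancellation: ½ dψ(I·Ix) = -½ dψ(x) = -γ(Ix).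
      rw [hb_apply, scalarAct_I_scalarAct_I, map_neg, hψ_euler y hy]
      ring
    · have h1 := ((hdecay.clm_comp Λ cobounded_le_principal_compl_zero hγ.1).fderiv).isBigO.norm_left
      have h2 := (hψ_decay.fderiv.fderiv).isBigO.norm_left
      refine IsBigO.trans (IsBigO.of_bound 1 ?_) (h1.add (h2.const_mul_left ‖K‖))
      filter_upwards [exterior_mem_cobounded 0] with y hy
      rw [exterior_zero] at hy
      rw [(hbD y hy).fderiv, Real.norm_of_nonneg (ContinuousLinearMap.opNorm_nonneg _), one_mul]
      refine le_trans ?_ (le_abs_self _)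
      exact (ContinuousLinearMap.opNorm_add_le _ _).trans
        (add_le_add le_rfl (K.opNorm_comp_le _))
  refine ⟨ψ, ⟨hψ, fun g hg x hx => ?_⟩, hψ_circle, fun x hx => ?_, hψ_decay, fun h => ?_⟩
  · refine radialIntegral_comp_of_invariant _ _ (hf_inv _ (fun y => ?_) fun y hy =>
      hγ.2 g hg y hy) hx
    simp [matAct, scalarAct_apply]
  · ext w
    rw [I_smul_ddbar_apply hψ hx]
    -- Closedness of b reads dγ = -½ d(dψ∘I).
    have h1 := hclosed x hx (w 0) (w 1)
    rw [hbD_apply x hx, hbD_apply x hx] at h1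
    have h2 := ha_ext x hx w
    change ((extDeriv γ x w : ℝ) : ℂ) = _
    congr 1
    linarith
  · have := hψ_ext 0 le_rfl (by rw [exterior_zero]; exact hf_decay _ le_rfl h)
    rwa [exterior_zero] at this
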